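/- Let $G$ be a locally compact Hausdorff étale groupoid with unit space $G^{(0)}$, range and source maps $r,s$, and let $G$ act freely and continuously (on the left) on a compact Hausdorff space $X$: there are a continuous surjection $r_X:X\to G^{(0)}$ and a continuous map $(g,x)\mapsto gx$ from $\{(g,x)\in G\times X: s(g)=r_X(x)\}$ to $X$ with $r_X(gx)=r(g)$, $g(hx)=(gh)x$ and $r_X(x)x=x$, and $gx=x$ implies $g=r_X(x)$. For $u\in G^{(0)}$ put $A(u)=C(r_X^{-1}(u))$; let $\mathcal A=\bigsqcup_u A(u)$ carry the bundle topology generated by the sets $\{b\in A(u): u\in U,\ \|b-a|_{r_X^{-1}(u)}\|<\varepsilon\}$ ($a\in C(X)$, $U\subset G^{(0)}$ open, $\varepsilon>0$); for $g\in G$ let $\alpha_g:A(s(g))\to A(r(g))$, $\alpha_g(f)(x)=f(g^{-1}x)$. Let $\Gamma_c(G,r^*\mathcal A)$ be the $*$-algebra of continuous compactly supported sections $f$, $f(g)\in A(r(g))$, with $$(f*k)(h)=\sum_{t\in G^{r(h)}}f(t)\,\alpha_t(k(t^{-1}h)),\qquad f^*(h)=\alpha_h(f(h^{-1})^*).$$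 For a unit $u$ and a unital $*$-representation $\pi$ of $A(u)$ on a (separable) Hilbert space $H$ let $L_\pi$ be the representation of $\Gamma_c(G,r^*\mathcal A)$ on $\ell^2(s^{-1}(u),H)$ given by $$(L_\pi(f)\xi)(g)=\sum_{t\in G^{r(g)}}\pi\big(\alpha_g^{-1}(f(t))\big)\,\xi(t^{-1}g).$$ The reduced crossed product $C(X)\rtimes_rG$ is the completion of $\Gamma_c(G,r^*\mathcal A)$ in the norm $\|f\|_r=\sup_{u,\pi}\|L_\pi(f)\|$. It contains $C(X)$: a function is identified with the section supported on $G^{(0)}$ whose value at $u$ is its restriction to $r_X^{-1}(u)$. Let $B\subset C(X)\rtimes_rG$ be a unital subalgebra (closed and self-adjoint or not) such that (i) $C(X)\subset B$; and (ii) $B\cap\Gamma_c(G,r^*\mathcal A)$ is dense in $B$. Let $a\in B$ be nonzero and positive in $C(X)\rtimes_rG$. Then there is a nonzero positive $b\in C(X)$ with $b\precsim_Ba$, i.e. there is a sequence $(r_n)_{n\in\mathbb N}$ in $B$ such that $b=\lim_{n\to\infty}r_n a r_n^*$ in norm. -/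

import Mathlib

open Set Filter Topology
open scoped ENNReal

/-- An étale topological groupoid with space of arrows `G` and unit space `G₀`. The unit space is
a separate type, embedded into `G` by `unit` (an embedding, since `r` is a continuous left inverse
of it). The product `mul g h` is only meaningful when `s g = r h`; its values on other pairs are
unconstrained and never used. -/
structure EtaleGroupoid (G G₀ : Type*) [TopologicalSpace G] [TopologicalSpace G₀] where
  r : G → G₀
  s : G → G₀
  unit : G₀ → G
  mul : G → G → G
  inv : G → G
  r_unit : ∀ u, r (unit u) = u
  s_unit : ∀ u, s (unit u) = u
  r_mul : ∀ g h, s g = r h → r (mul g h) = r g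
  s_mul : ∀ g h, s g = r h → s (mul g h) = s h
  mul_assoc : ∀ g h k, s g = r h → s h = r k → mul (mul g h) k = mul g (mul h k)
  unit_mul : ∀ g, mul (unit (r g)) g = g
  mul_unit : ∀ g, mul g (unit (s g)) = g
  r_inv : ∀ g, r (inv g) = s g
  s_inv : ∀ g, s (inv g) = r g
  inv_mul : ∀ g, mul (inv g) g = unit (s g)
  mul_inv : ∀ g, mul g (inv g) = unit (r g)
  continuous_unit : Continuous unit
  continuous_inv : Continuous inv
  continuousOn_mul : ContinuousOn (fun p : G × G => mul p.1 p.2) {p | s p.1 = r p.2}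
  isLocalHomeomorph_r : IsLocalHomeomorph r
  isLocalHomeomorph_s : IsLocalHomeomorph s

namespace EtaleGroupoid

/-- A continuous left action of a groupoid on a space `X`, with continuous surjective anchor map
`rX : X → G₀`. The value `act g x` is only meaningful when `s g = rX x`; other values are
unconstrained and never used. -/
structure Action {G G₀ : Type*} [TopologicalSpace G] [TopologicalSpace G₀]
    (𝒢 : EtaleGroupoid G G₀) (X : Type*) [TopologicalSpace X] where
  rX : X → G₀
  act : G → X → X
  surjective_rX : Function.Surjective rX
  rX_act : ∀ g x, 𝒢.s g = rX x → rX (act g x) = 𝒢.r g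
  act_act : ∀ g h x, 𝒢.s g = 𝒢.r h → 𝒢.s h = rX x → act g (act h x) = act (𝒢.mul g h) x
  unit_act : ∀ x, act (𝒢.unit (rX x)) x = x
  continuous_rX : Continuous rX
  continuousOn_act : ContinuousOn (fun p : G × X => act p.1 p.2) {p | 𝒢.s p.1 = rX p.2}

namespace Action

theorem lp_tsum_enorm_sq {ι : Type*} {E : ι → Type*} [∀ i, NormedAddCommGroup (E i)]
    (h : lp E 2) :
    ∑' p, ‖h p‖ₑ ^ 2 = ENNReal.ofReal (‖h‖ ^ 2) := by
  have h2 : (0 : ℝ) < (2 : ℝ≥0∞).toReal := by norm_num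
  have hs := lp.hasSum_norm h2 h
  simp only [ENNReal.toReal_ofNat, Real.rpow_ofNat] at hs
  rw [← hs.tsum_eq, ENNReal.ofReal_tsum_of_nonneg (fun _ => by positivity) hs.summable]
  simp only [← ofReal_norm, ENNReal.ofReal_pow (norm_nonneg _)]

theorem lp_memℓp_of_tsum_le {ι : Type*} {E : ι → Type*} [∀ i, NormedAddCommGroup (E i)]
    {x : ∀ i, E i} {D : ℝ}
    (hx : ∑' p, ‖x p‖ₑ ^ 2 ≤ ENNReal.ofReal D) : Memℓp x 2 := by
  have h1 : ∑' p, ((‖x p‖₊ ^ 2 : NNReal) : ℝ≥0∞) ≠ ⊤ := by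
    simp only [ENNReal.coe_pow, ← enorm_eq_nnnorm]
    exact ne_top_of_le_ne_top ENNReal.ofReal_ne_top hx
  have h2 := NNReal.summable_coe.mpr (ENNReal.tsum_coe_ne_top_iff_summable.mp h1)
  refine memℓp_gen ?_
  simpa using h2

theorem lp_norm_sq_le_of_tsum_le {ι : Type*} {E : ι → Type*} [∀ i, NormedAddCommGroup (E i)]
    {h : lp E 2} {D : ℝ} (hD : 0 ≤ D)
    (hx : ∑' p, ‖h p‖ₑ ^ 2 ≤ ENNReal.ofReal D) : ‖h‖ ^ 2 ≤ D := by
  rw [lp_tsum_enorm_sq] at hx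
  exact (ENNReal.ofReal_le_ofReal_iff hD).mp hx

section Defs

variable {G G₀ X : Type*} [TopologicalSpace G] [TopologicalSpace G₀] [TopologicalSpace X]
  {𝒢 : EtaleGroupoid G G₀}

/-- The action is free: only units have fixed points. -/
def IsFree (α : 𝒢.Action X) : Prop :=
  ∀ (g : G) (x : X), 𝒢.s g = α.rX x → α.act g x = x → g = 𝒢.unit (α.rX x)

/-- The fibre `r_X⁻¹(u)` of `X` over a unit `u`. -/
abbrev Fibre (α : 𝒢.Action X) (u : G₀) : Type _ := {x : X // α.rX x = u}

theorem isClosed_fibre [T2Space G₀] (α : 𝒢.Action X) (u : G₀) :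
    IsClosed {x : X | α.rX x = u} :=
  isClosed_eq α.continuous_rX continuous_const

instance compactSpace_fibre [T2Space G₀] [CompactSpace X] (α : 𝒢.Action X) (u : G₀) :
    CompactSpace (α.Fibre u) :=
  isCompact_iff_compactSpace.mp (α.isClosed_fibre u).isCompact

/-- The image `a(u)` of `a ∈ C(X)` in the fibre algebra `A(u) = C(r_X⁻¹(u))`. -/
noncomputable def restr (α : 𝒢.Action X) (a : C(X, ℂ)) (u : G₀) : C(α.Fibre u, ℂ) :=
  ⟨fun x => a x.1, a.continuous.comp continuous_subtype_val⟩

/-- The homeomorphism `r_X⁻¹(u) → r_X⁻¹(v)`, `x ↦ g x`, for an arrow `g` from `u` to `v`. -/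
def translate (α : 𝒢.Action X) {u v : G₀} (g : G) (hs : 𝒢.s g = u) (hr : 𝒢.r g = v) :
    C(α.Fibre u, α.Fibre v) where
  toFun x := ⟨α.act g x.1, (α.rX_act g x.1 (hs.trans x.2.symm)).trans hr⟩
  continuous_toFun := by
    refine Continuous.subtype_mk ?_ _
    have h : Continuous (fun x : α.Fibre u =>
        (⟨(g, x.1), hs.trans x.2.symm⟩ : {p : G × X | 𝒢.s p.1 = α.rX p.2})) :=
      Continuous.subtype_mk (continuous_const.prodMk continuous_subtype_val) _
    exact (continuousOn_iff_continuous_domRestrict.mp α.continuousOn_act).comp h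

/-- The inverse `α_g⁻¹ : A(v) → A(u)` of the isomorphism `α_g : A(u) → A(v)`,
`α_g(f)(x) = f(g⁻¹ x)`, induced by an arrow `g` from `u` to `v`; that is,
`α_g⁻¹(f)(x) = f(g x)`. -/
noncomputable def pull (α : 𝒢.Action X) {u v : G₀} (g : G) (hs : 𝒢.s g = u) (hr : 𝒢.r g = v)
    (f : C(α.Fibre v, ℂ)) : C(α.Fibre u, ℂ) :=
  f.comp (α.translate g hs hr)

/-- The total space `𝒜 = ⨆ᵤ A(u)` of the bundle of C⋆-algebras over `G₀` associated to `C(X)`. -/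
structure Bundle (α : 𝒢.Action X) where
  base : G₀
  val : C(α.Fibre base, ℂ)

/-- A compact set meets the fibres of a local homeomorphism in boundedly many points. -/
theorem exists_card_bound {φ : G → G₀} (hφ : IsLocalHomeomorph φ) {K : Set G} (hK : IsCompact K) :
    ∃ N : ℕ, ∀ v : G₀, {t | t ∈ K ∧ φ t = v}.encard ≤ N := by
  refine IsCompact.induction_on (p := fun K => ∃ N : ℕ, ∀ v : G₀,
    {t | t ∈ K ∧ φ t = v}.encard ≤ N) hK ⟨0, fun v => by simp⟩ ?_ ?_ ?_
  · rintro s t hst ⟨N, hN⟩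
    exact ⟨N, fun v => (Set.encard_le_encard
      (show {x | x ∈ s ∧ φ x = v} ⊆ {x | x ∈ t ∧ φ x = v} from
        fun _ hx => ⟨hst hx.1, hx.2⟩)).trans (hN v)⟩
  · rintro s t ⟨N, hN⟩ ⟨M, hM⟩
    refine ⟨N + M, fun v => ?_⟩
    refine le_trans (Set.encard_le_encard (t := {x | x ∈ s ∧ φ x = v} ∪ {x | x ∈ t ∧ φ x = v}) ?_)
      ((Set.encard_union_le _ _).trans ((add_le_add (hN v) (hM v)).trans (by simp)))
    rintro x ⟨h | h, h'⟩
    · exact Or.inl ⟨h, h'⟩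
    · exact Or.inr ⟨h, h'⟩
  · intro x _
    obtain ⟨e, hx, he⟩ := hφ x
    refine ⟨e.source, mem_nhdsWithin_of_mem_nhds (e.open_source.mem_nhds hx), 1, fun v => ?_⟩
    rw [Nat.cast_one, Set.encard_le_one_iff]
    rintro a b ⟨ha, ha'⟩ ⟨hb, hb'⟩
    refine e.injOn ha hb ?_
    rw [← he]; exact ha'.trans hb'.symm

variable [T2Space G₀] [CompactSpace X]

/-- The topology of the bundle, generated by the tubes
`W(a, U, ε) = {b ∈ A(u) : u ∈ U, ‖b - a(u)‖ < ε}` with `a ∈ C(X)`, `U ⊆ G₀` open, `ε > 0`. -/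
noncomputable instance (α : 𝒢.Action X) : TopologicalSpace α.Bundle :=
  TopologicalSpace.generateFrom
    {W | ∃ (a : C(X, ℂ)) (U : Set G₀) (ε : ℝ), IsOpen U ∧ 0 < ε ∧
      W = {b : α.Bundle | b.base ∈ U ∧ ‖b.val - α.restr a b.base‖ < ε}}

/-- `Γ_c(G, r⋆𝒜)`: continuous compactly supported sections of the pull-back of the bundle `𝒜`
along the range map. -/
structure Section (α : 𝒢.Action X) where
  toFun : (g : G) → C(α.Fibre (𝒢.r g), ℂ)
  continuous_toFun : Continuous (fun g => (⟨𝒢.r g, toFun g⟩ : α.Bundle))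
  isCompact_support : IsCompact (closure {g | toFun g ≠ 0})

/-- A (unital, hence nondegenerate) representation `π` of a fibre algebra `A(u)` on a Hilbert
space `H`. -/
structure FibreRep (α : 𝒢.Action X) where
  u : G₀
  H : Type
  [normed : NormedAddCommGroup H]
  [inner : InnerProductSpace ℂ H]
  [complete : CompleteSpace H]
  π : C(α.Fibre u, ℂ) →⋆ₐ[ℂ] (H →L[ℂ] H)

attribute [instance] FibreRep.normed FibreRep.inner FibreRep.complete

/-- An index of the Hilbert space of the regular representation: a unit `u`, a representation `π`
of `A(u)`, and an arrow `g` with source `u`. -/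
structure RegIndex (α : 𝒢.Action X) where
  rep : α.FibreRep
  g : G
  hg : 𝒢.s g = rep.u

/-- The Hilbert space `⨁_{(u, π)} ℓ²(G_u, H_π)`, the sum over all units `u` and all
representations `π` of `A(u)`. -/
abbrev RegSpace (α : 𝒢.Action X) : Type _ := lp (fun p : α.RegIndex => p.rep.H) 2

/-- `(u, π, g) ↦ (u, π, t⁻¹ g)`, for `r t = r g`. -/
def RegIndex.shift {α : 𝒢.Action X} (p : α.RegIndex) (t : G) (ht : 𝒢.r t = 𝒢.r p.g) :
    α.RegIndex where
  rep := p.rep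
  g := 𝒢.mul (𝒢.inv t) p.g
  hg := (𝒢.s_mul _ _ ((𝒢.s_inv t).trans ht)).trans p.hg

/-- The integrated left regular representations, all at once:
`(L_π(f) h)(g) = ∑_{t ∈ G^{r(g)}} π(α_g⁻¹(f(t))) h(t⁻¹ g)` for `h ∈ ℓ²(G_u, H_π)`.
The sum has only finitely many nonzero terms. -/
noncomputable def regFun {α : 𝒢.Action X} (f : α.Section) (h : ∀ p : α.RegIndex, p.rep.H)
    (p : α.RegIndex) : p.rep.H :=
  ∑ᶠ t : {t : G // 𝒢.r t = 𝒢.r p.g},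
    p.rep.π (α.pull p.g p.hg t.2.symm (f.toFun t.1)) (h (p.shift t.1 t.2))

/-- Continuous compactly supported sections are bounded. -/
theorem Section.exists_bound [T2Space X] {α : 𝒢.Action X} (f : α.Section) :
    ∃ M : NNReal, ∀ t, ‖f.toFun t‖₊ ≤ M := by
  have key : ∃ M : NNReal, ∀ t ∈ closure {g | f.toFun g ≠ 0}, ‖f.toFun t‖₊ ≤ M := by
    refine IsCompact.induction_on (p := fun K => ∃ M : NNReal, ∀ t ∈ K, ‖f.toFun t‖₊ ≤ M)
      f.isCompact_support ⟨0, by simp⟩ ?_ ?_ ?_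
    · rintro s t hst ⟨M, hM⟩
      exact ⟨M, fun x hx => hM x (hst hx)⟩
    · rintro s t ⟨M, hM⟩ ⟨N, hN⟩
      refine ⟨max M N, ?_⟩
      rintro x (hx | hx)
      · exact (hM x hx).trans (le_max_left _ _)
      · exact (hN x hx).trans (le_max_right _ _)
    · intro g _
      obtain ⟨a, ha⟩ := ContinuousMap.exists_restrict_eq (α.isClosed_fibre (𝒢.r g)) (f.toFun g)
      have ha' : α.restr a (𝒢.r g) = f.toFun g := ha
      let W : Set α.Bundle := {b | b.base ∈ (univ : Set G₀) ∧ ‖b.val - α.restr a b.base‖ < 1}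
      have hW : IsOpen W := TopologicalSpace.isOpen_generateFrom_of_mem
        ⟨a, univ, 1, isOpen_univ, one_pos, rfl⟩
      refine ⟨_, mem_nhdsWithin_of_mem_nhds ((hW.preimage f.continuous_toFun).mem_nhds ?_),
        ‖a‖₊ + 1, ?_⟩
      · exact ⟨mem_univ _, by simp [ha']⟩
      · rintro t ⟨-, ht⟩
        have h1 : ‖α.restr a (𝒢.r t)‖ ≤ ‖a‖ :=
          (ContinuousMap.norm_le _ (norm_nonneg _)).mpr fun x => a.norm_coe_le_norm x.1
        have h2 : ‖f.toFun t‖ ≤ ‖f.toFun t - α.restr a (𝒢.r t)‖ + ‖α.restr a (𝒢.r t)‖ := by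
          simpa using norm_add_le (f.toFun t - α.restr a (𝒢.r t)) (α.restr a (𝒢.r t))
        have h3 : ‖f.toFun t - α.restr a (𝒢.r t)‖ < 1 := ht
        rw [← NNReal.coe_le_coe]
        push_cast
        linarith
  obtain ⟨M, hM⟩ := key
  refine ⟨M, fun t => ?_⟩
  by_cases ht : f.toFun t = 0
  · simp [ht]
  · exact hM t (subset_closure ht)

/-- `L(f)` is bounded for the `ℓ²`-norm. -/
theorem regFun_bound [T2Space X] {α : 𝒢.Action X} (f : α.Section) :
    ∃ C : NNReal, ∀ h : (∀ p : α.RegIndex, p.rep.H),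
      ∑' p, ‖regFun f h p‖ₑ ^ 2 ≤ C * ∑' p, ‖h p‖ₑ ^ 2 := by
  obtain ⟨M, hM⟩ := f.exists_bound
  set K := closure {g | f.toFun g ≠ 0} with hK
  obtain ⟨N, hN⟩ := exists_card_bound 𝒢.isLocalHomeomorph_r f.isCompact_support
  obtain ⟨N', hN'⟩ := exists_card_bound 𝒢.isLocalHomeomorph_s f.isCompact_support
  refine ⟨N * M ^ 2 * N', fun h => ?_⟩
  have hpt : ∀ p : α.RegIndex, ‖regFun f h p‖ₑ ^ 2 ≤
      (N * M ^ 2 : NNReal) * ∑' t : {t | t ∈ K ∧ 𝒢.r t = 𝒢.r p.g},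
        ‖h (p.shift t.1 t.2.2)‖ₑ ^ 2 := by
    intro p
    have hfin : {t | t ∈ K ∧ 𝒢.r t = 𝒢.r p.g}.Finite :=
      Set.finite_of_encard_le_coe (hN _)
    let _ : Fintype {t | t ∈ K ∧ 𝒢.r t = 𝒢.r p.g} := hfin.fintype
    have hcard : Fintype.card {t | t ∈ K ∧ 𝒢.r t = 𝒢.r p.g} ≤ N := by
      have := hN (𝒢.r p.g)
      rw [Set.encard_eq_coe_toFinset_card, Set.toFinset_card] at this
      exact_mod_cast this
    let e : {t | t ∈ K ∧ 𝒢.r t = 𝒢.r p.g} ↪ {t : G // 𝒢.r t = 𝒢.r p.g} :=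
      ⟨fun t => ⟨t.1, t.2.2⟩, fun a b hab => Subtype.ext (by simpa using hab)⟩
    have hsum : regFun f h p = ∑ t : {t | t ∈ K ∧ 𝒢.r t = 𝒢.r p.g},
        p.rep.π (α.pull p.g p.hg t.2.2.symm (f.toFun t.1)) (h (p.shift t.1 t.2.2)) := by
      unfold regFun
      rw [finsum_eq_sum_of_support_subset (s := Finset.univ.map e), Finset.sum_map]
      · rfl
      · intro t ht
        have h0 : f.toFun t.1 ≠ 0 := by
          intro h0
          apply ht
          have : α.pull p.g p.hg t.2.symm (f.toFun t.1) = 0 := by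
            ext x; simp [pull, h0]
          simp only [this, map_zero]
          rfl
        simp only [Finset.coe_map, Finset.coe_univ, Set.image_univ]
        exact ⟨⟨t.1, subset_closure h0, t.2⟩, rfl⟩
    have hterm : ∀ t : {t | t ∈ K ∧ 𝒢.r t = 𝒢.r p.g},
        ‖p.rep.π (α.pull p.g p.hg t.2.2.symm (f.toFun t.1)) (h (p.shift t.1 t.2.2))‖₊
          ≤ M * ‖h (p.shift t.1 t.2.2)‖₊ := by
      intro t
      refine (ContinuousLinearMap.le_opNNNorm _ _).trans ?_
      refine mul_le_mul_left ?_ _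
      refine le_trans ?_ (hM t.1)
      have h1 : ‖p.rep.π (α.pull p.g p.hg t.2.2.symm (f.toFun t.1))‖ ≤
          ‖α.pull p.g p.hg t.2.2.symm (f.toFun t.1)‖ :=
        NonUnitalStarAlgHom.norm_apply_le p.rep.π _
      refine le_trans (b := ‖α.pull p.g p.hg t.2.2.symm (f.toFun t.1)‖₊) h1 ?_
      exact (ContinuousMap.norm_le _ (norm_nonneg _)).mpr fun x =>
        (f.toFun t.1).norm_coe_le_norm _
    have hreal : ‖regFun f h p‖₊ ^ 2 ≤ (N * M ^ 2 : NNReal) *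
        ∑ t : {t | t ∈ K ∧ 𝒢.r t = 𝒢.r p.g}, ‖h (p.shift t.1 t.2.2)‖₊ ^ 2 := by
      calc ‖regFun f h p‖₊ ^ 2
          ≤ (∑ t : {t | t ∈ K ∧ 𝒢.r t = 𝒢.r p.g}, M * ‖h (p.shift t.1 t.2.2)‖₊) ^ 2 := by
            gcongr
            rw [hsum]
            exact (nnnorm_sum_le _ _).trans (Finset.sum_le_sum fun t _ => hterm t)
        _ ≤ (Fintype.card {t | t ∈ K ∧ 𝒢.r t = 𝒢.r p.g} : NNReal) *
              ∑ t : {t | t ∈ K ∧ 𝒢.r t = 𝒢.r p.g}, (M * ‖h (p.shift t.1 t.2.2)‖₊) ^ 2 :=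
            sq_sum_le_card_mul_sum_sq
        _ ≤ N * ∑ t : {t | t ∈ K ∧ 𝒢.r t = 𝒢.r p.g}, (M * ‖h (p.shift t.1 t.2.2)‖₊) ^ 2 := by
            gcongr
        _ = _ := by
            simp only [mul_pow, ← Finset.mul_sum]
            rw [_root_.mul_assoc]
    have hen : ((‖regFun f h p‖₊ ^ 2 : NNReal) : ℝ≥0∞) ≤ ((N * M ^ 2 : NNReal) *
        ∑ t : {t | t ∈ K ∧ 𝒢.r t = 𝒢.r p.g}, ‖h (p.shift t.1 t.2.2)‖₊ ^ 2 : NNReal) :=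
      ENNReal.coe_le_coe.mpr hreal
    rw [tsum_fintype]
    rw [ENNReal.coe_mul, ENNReal.ofNNReal_finsetSum] at hen
    simpa only [ENNReal.coe_pow, enorm_eq_nnnorm] using hen
  let ι : (Σ p : α.RegIndex, {t | t ∈ K ∧ 𝒢.r t = 𝒢.r p.g}) →
      (Σ q : α.RegIndex, {t | t ∈ K ∧ 𝒢.s t = 𝒢.r q.g}) := fun x =>
    ⟨x.1.shift x.2.1 x.2.2.2, x.2.1, x.2.2.1, by
      have := 𝒢.r_mul (𝒢.inv x.2.1) x.1.g ((𝒢.s_inv _).trans x.2.2.2)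
      exact ((𝒢.r_inv _).symm.trans this.symm)⟩
  have hι : Function.Injective ι := by
    rintro ⟨⟨ρ, g, hg⟩, ⟨t, ht, ht'⟩⟩ ⟨⟨ρ', g', hg'⟩, ⟨t', hs, hs'⟩⟩ hx
    have h1 := congrArg (fun y => y.1.rep) hx
    have h2 := congrArg (fun y => y.2.1) hx
    have h3 := congrArg (fun y => y.1.g) hx
    simp only [ι, RegIndex.shift] at h1 h2 h3 ht' hs'
    subst h1 h2
    have : ∀ k, 𝒢.r t = 𝒢.r k → 𝒢.mul t (𝒢.mul (𝒢.inv t) k) = k := by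
      intro k hk
      rw [← 𝒢.mul_assoc _ _ _ (𝒢.r_inv t).symm ((𝒢.s_inv t).trans hk), 𝒢.mul_inv, hk, 𝒢.unit_mul]
    have h4 : g = g' := by rw [← this g ht', ← this g' hs', h3]
    subst h4
    rfl
  calc ∑' p, ‖regFun f h p‖ₑ ^ 2
      ≤ ∑' p : α.RegIndex, (N * M ^ 2 : NNReal) * ∑' t : {t | t ∈ K ∧ 𝒢.r t = 𝒢.r p.g},
        ‖h (p.shift t.1 t.2.2)‖ₑ ^ 2 := ENNReal.tsum_le_tsum hpt
    _ = (N * M ^ 2 : NNReal) * ∑' x : (Σ p : α.RegIndex, {t | t ∈ K ∧ 𝒢.r t = 𝒢.r p.g}),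
        ‖h (ι x).1‖ₑ ^ 2 := by
      rw [ENNReal.tsum_mul_left, ENNReal.tsum_sigma']
    _ ≤ (N * M ^ 2 : NNReal) * ∑' y : (Σ q : α.RegIndex, {t | t ∈ K ∧ 𝒢.s t = 𝒢.r q.g}),
        ‖h y.1‖ₑ ^ 2 := by
      gcongr
      exact ENNReal.tsum_comp_le_tsum_of_injective hι (fun y => ‖h y.1‖ₑ ^ 2)
    _ ≤ (N * M ^ 2 : NNReal) * ∑' q : α.RegIndex, (N' : ℝ≥0∞) * ‖h q‖ₑ ^ 2 := by
      rw [ENNReal.tsum_sigma']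
      gcongr with q
      refine (ENNReal.tsum_const (‖h q‖ₑ ^ 2)).trans_le ?_
      gcongr
      exact_mod_cast hN' (𝒢.r q.g)
    _ = _ := by
      rw [ENNReal.tsum_mul_left, ← _root_.mul_assoc]
      push_cast
      rfl

theorem finite_support_regFun {α : 𝒢.Action X} (f : α.Section) (h : ∀ p : α.RegIndex, p.rep.H)
    (p : α.RegIndex) :
    (Function.support fun t : {t : G // 𝒢.r t = 𝒢.r p.g} =>
      p.rep.π (α.pull p.g p.hg t.2.symm (f.toFun t.1)) (h (p.shift t.1 t.2))).Finite := by
  obtain ⟨N, hN⟩ := exists_card_bound 𝒢.isLocalHomeomorph_r f.isCompact_support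
  refine ((Set.finite_of_encard_le_coe (hN (𝒢.r p.g))).preimage
    Subtype.val_injective.injOn).subset ?_
  intro t ht
  refine ⟨subset_closure fun h0 => ht ?_, t.2⟩
  have : α.pull p.g p.hg t.2.symm (f.toFun t.1) = 0 := by
    ext x; simp [pull, h0]
  simp only [this, map_zero]
  rfl

/-- The operator `L(f) = ⨁_{(u, π)} L_π(f)` on `⨁_{(u, π)} ℓ²(G_u, H_π)`. Its norm is the reduced
norm `sup_{(u, π)} ‖L_π(f)‖` of `f`. -/
noncomputable def regRep [T2Space X] (α : 𝒢.Action X) (f : α.Section) :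
    α.RegSpace →L[ℂ] α.RegSpace :=
  have key : ∃ C : NNReal, ∀ h : α.RegSpace,
      ∑' p, ‖regFun f h p‖ₑ ^ 2 ≤ ENNReal.ofReal (C * ‖h‖ ^ 2) := by
    obtain ⟨C, hC⟩ := regFun_bound f
    refine ⟨C, fun h => (hC h).trans_eq ?_⟩
    rw [lp_tsum_enorm_sq, ENNReal.ofReal_mul C.coe_nonneg, ENNReal.ofReal_coe_nnreal]
  LinearMap.mkContinuousOfExistsBound
    { toFun := fun h => ⟨regFun f h, lp_memℓp_of_tsum_le (key.choose_spec h)⟩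
      map_add' := fun h k => by
        refine lp.ext (funext fun p => ?_)
        change regFun f ⇑(h + k) p = regFun f h p + regFun f k p
        unfold regFun
        rw [← finsum_add_distrib (finite_support_regFun f h p) (finite_support_regFun f k p)]
        exact finsum_congr fun t => map_add _ _ _
      map_smul' := fun c h => by
        refine lp.ext (funext fun p => ?_)
        change regFun f ⇑(c • h) p = c • regFun f h p
        unfold regFun
        rw [smul_finsum' _ (finite_support_regFun f h p)]
        exact finsum_congr fun t => map_smul _ _ _ }
    (by
      obtain ⟨C, hC⟩ := key
      refine ⟨Real.sqrt C, fun h => ?_⟩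
      have h1 := lp_norm_sq_le_of_tsum_le (by positivity)
        (h := (⟨regFun f h, lp_memℓp_of_tsum_le (hC h)⟩ : α.RegSpace)) (hC h)
      refine (pow_le_pow_iff_left₀ (norm_nonneg _) (by positivity) two_ne_zero).mp ?_
      rw [mul_pow, Real.sq_sqrt C.coe_nonneg]
      exact h1)

theorem regRep_apply [T2Space X] (α : 𝒢.Action X) (f : α.Section) (h : α.RegSpace)
    (p : α.RegIndex) : regRep α f h p = regFun f h p := rfl

/-- The reduced crossed product `C(X) ⋊_r G`: the completion of `Γ_c(G, r⋆𝒜)` in the reduced norm,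
realised as the C⋆-algebra generated by the operators `L(f)`, `f ∈ Γ_c(G, r⋆𝒜)`. Composition and
adjoint of these operators implement the convolution
`(f * k)(h) = ∑_{t ∈ G^{r(h)}} f(t) α_t(k(t⁻¹ h))` and the involution `f⋆(h) = α_h(f(h⁻¹)⋆)`; in
particular their range is a unital ⋆-subalgebra, and the crossed product is its norm closure. -/
noncomputable def crossedProduct [T2Space X] (α : 𝒢.Action X) :
    StarSubalgebra ℂ (α.RegSpace →L[ℂ] α.RegSpace) :=
  (StarAlgebra.adjoin ℂ (Set.range (regRep α))).topologicalClosure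

/-- The canonical map `Γ_c(G, r⋆𝒜) → C(X) ⋊_r G`. -/
noncomputable def ofSection [T2Space X] (α : 𝒢.Action X) (f : α.Section) : α.crossedProduct :=
  ⟨regRep α f, StarSubalgebra.le_topologicalClosure _
    (StarAlgebra.subset_adjoin ℂ _ (Set.mem_range_self f))⟩

/-- Restricting a function on `X` to the fibres gives a continuous section of `𝒜`. -/
theorem continuous_restr (α : 𝒢.Action X) (a : C(X, ℂ)) :
    Continuous (fun u => (⟨u, α.restr a u⟩ : α.Bundle)) := by
  refine continuous_generateFrom_iff.mpr ?_
  rintro _ ⟨b, U, ε, hU, hε, rfl⟩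
  have hcl : IsClosed (α.rX '' {x | ε ≤ ‖a x - b x‖}) :=
    ((isClosed_le continuous_const (by fun_prop)).isCompact.image α.continuous_rX).isClosed
  convert hU.inter hcl.isOpen_compl using 1
  ext u
  simp only [mem_preimage, mem_ofPred_eq, mem_inter_iff, mem_compl_iff, mem_image, not_exists,
    not_and, ContinuousMap.norm_lt_iff _ hε]
  refine and_congr_right fun _ => ⟨fun h x hx hu => ?_, fun h x => ?_⟩
  · exact absurd (h ⟨x, hu⟩) (not_lt.mpr hx)
  · by_contra hx
    exact h x.1 (not_lt.mp hx) x.2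

end Defs

end Action

section Unit

variable {G G₀ : Type*} [TopologicalSpace G] [TopologicalSpace G₀]

theorem isOpen_range_unit (𝒢 : EtaleGroupoid G G₀) : IsOpen (range 𝒢.unit) := by
  rw [isOpen_iff_mem_nhds]
  rintro _ ⟨u, rfl⟩
  obtain ⟨e, he, hs⟩ := 𝒢.isLocalHomeomorph_s (𝒢.unit u)
  have hc : Continuous fun g => 𝒢.unit (𝒢.s g) :=
    𝒢.continuous_unit.comp 𝒢.isLocalHomeomorph_s.continuous
  have h1 : e.source ∈ 𝓝 (𝒢.unit u) := e.open_source.mem_nhds he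
  have h2 : (fun g => 𝒢.unit (𝒢.s g)) ⁻¹' e.source ∈ 𝓝 (𝒢.unit u) :=
    hc.continuousAt.preimage_mem_nhds (by simpa only [𝒢.s_unit] using h1)
  filter_upwards [h1, h2] with g hg hg'
  refine ⟨𝒢.s g, e.injOn hg' hg ?_⟩
  rw [← hs, 𝒢.s_unit]

theorem isClosed_range_unit [T2Space G] (𝒢 : EtaleGroupoid G G₀) : IsClosed (range 𝒢.unit) := by
  have : range 𝒢.unit = {g | 𝒢.unit (𝒢.s g) = g} := by
    ext g
    exact ⟨by rintro ⟨u, rfl⟩; simp only [mem_ofPred_eq, 𝒢.s_unit], fun h => ⟨_, h⟩⟩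
  rw [this]
  exact isClosed_eq (𝒢.continuous_unit.comp 𝒢.isLocalHomeomorph_s.continuous) continuous_id

end Unit

namespace Action

section Functions

variable {G G₀ X : Type*} [TopologicalSpace G] [TopologicalSpace G₀] [TopologicalSpace X]
  {𝒢 : EtaleGroupoid G G₀} [T2Space G₀] [CompactSpace X] [T2Space G]

open Classical in
/-- The inclusion `C(X) ⊆ Γ_c(G, r⋆𝒜)`: the function `a` is the section supported on the units
whose value at a unit `u` is `a(u) ∈ A(u)`. -/
noncomputable def ofFunction (α : 𝒢.Action X) (a : C(X, ℂ)) : α.Section where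
  toFun g := if g ∈ range 𝒢.unit then α.restr a (𝒢.r g) else 0
  continuous_toFun := by
    have h0 : ∀ u, α.restr 0 u = 0 := fun u => rfl
    have : (fun g => (⟨𝒢.r g, if g ∈ range 𝒢.unit then α.restr a (𝒢.r g) else 0⟩ : α.Bundle)) =
        fun g => if g ∈ range 𝒢.unit then (⟨𝒢.r g, α.restr a (𝒢.r g)⟩ : α.Bundle)
          else ⟨𝒢.r g, α.restr 0 (𝒢.r g)⟩ := by
      funext g
      split_ifs <;> rfl
    rw [this]
    refine continuous_if ?_ ?_ ?_
    · have hcl : IsClopen {g | g ∈ range 𝒢.unit} := ⟨𝒢.isClosed_range_unit, 𝒢.isOpen_range_unit⟩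
      intro g hg
      rw [hcl.frontier_eq] at hg
      exact hg.elim
    · exact ((α.continuous_restr a).comp 𝒢.isLocalHomeomorph_r.continuous).continuousOn
    · exact ((α.continuous_restr 0).comp 𝒢.isLocalHomeomorph_r.continuous).continuousOn
  isCompact_support := by
    have hc : IsCompact (range 𝒢.unit) := by
      have h1 : IsCompact (range α.rX) := isCompact_range α.continuous_rX
      rw [α.surjective_rX.range_eq] at h1
      rw [← image_univ]
      exact h1.image 𝒢.continuous_unit
    refine hc.of_isClosed_subset isClosed_closure (closure_minimal ?_ 𝒢.isClosed_range_unit)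
    intro g hg
    by_contra h
    exact hg (if_neg h)

/-- The inclusion `C(X) ⊆ C(X) ⋊_r G`. -/
noncomputable def incl [T2Space X] (α : 𝒢.Action X) (a : C(X, ℂ)) : α.crossedProduct :=
  α.ofSection (α.ofFunction a)

end Functions

end Action
end EtaleGroupoid

/-- Positive elements of a C⋆-algebra. -/
def IsPositiveElem {A : Type*} [Mul A] [Star A] (a : A) : Prop :=
  ∃ c : A, a = star c * c

/-- Cuntz subequivalence of `a` to `b` over a subalgebra `B` of a C⋆-algebra `A`:
`a = lim rₙ b rₙ⋆` for a sequence `rₙ` in `B`. -/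
def CuntzSubequiv {A : Type*} [Ring A] [Algebra ℂ A] [Star A] [TopologicalSpace A]
    (B : Subalgebra ℂ A) (a b : A) : Prop :=
  ∃ r : ℕ → A, (∀ n, r n ∈ B) ∧ Tendsto (fun n => r n * b * star (r n)) atTop (𝓝 a)

/-!
Let `φ` be a bump function near a point `x` with trivial isotropy. By compactness, no arrow of the
support of a section `f` other than a unit carries a point near `x` to a point near `x`, so
compressing `f` by `φ` kills everything but its restriction to the units. That restriction extends
to the conditional expectation of the crossed product onto `C(X)`, which is faithful: its value at
`x` is the matrix coefficient at a basis vector `ξ_x` of the regular representation, and the `ξ_x`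
determine the operator. Hence the expectation of a nonzero `T ≥ 0` is positive at a suitable `x`,
and compressing a section close to `T` yields `κ ψ² ≤ ψ T ψ` for some `κ > 0` and a smaller bump
function `ψ`. With `y = ψ T ψ` and `w = (y + η)^(-1/2)`, the elements `(ψ w ψ) T (ψ w ψ)` then
converge to `ψ²` as `η → 0`.
-/

section CuntzComparison

theorem cuntzSubequiv_iff_mem_closure {A : Type*} [Ring A] [Algebra ℂ A] [Star A]
    [TopologicalSpace A] [FrechetUrysohnSpace A] {B : Subalgebra ℂ A} {a b : A} :
    CuntzSubequiv B b a ↔ b ∈ closure ((fun r => r * a * star r) '' (B : Set A)) := by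
  rw [mem_closure_iff_seq_limit]
  constructor
  · rintro ⟨r, hrB, hr⟩
    exact ⟨_, fun n => mem_image_of_mem _ (hrB n), hr⟩
  · rintro ⟨u, huB, hu⟩
    choose r hrB hr using huB
    exact ⟨r, hrB, by simpa only [hr] using hu⟩

theorem CuntzSubequiv.of_map {A A' : Type*} [Ring A] [Algebra ℂ A] [Star A] [TopologicalSpace A]
    [Ring A'] [Algebra ℂ A'] [Star A'] [TopologicalSpace A'] {B : Subalgebra ℂ A} {a b : A}
    (ι : A →⋆ₐ[ℂ] A') (hι : IsInducing ι)
    (h : CuntzSubequiv (B.map ι.toAlgHom) (ι b) (ι a)) : CuntzSubequiv B b a := by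
  obtain ⟨r, hrB, hr⟩ := h
  choose r' hr'B hr' using hrB
  obtain rfl : (fun n => ι (r' n)) = r := funext hr'
  refine ⟨r', hr'B, hι.tendsto_nhds_iff.mpr ?_⟩
  simpa only [Function.comp_def, map_mul, map_star] using hr

theorem norm_mul_sq_le_of_smul_mul_self_le {A : Type*} [NonUnitalCStarAlgebra A] [PartialOrder A]
    [StarOrderedRing A] {e y : A} (he : IsSelfAdjoint e) {κ : ℝ} (hκ : 0 < κ)
    (hey : κ • (e * e) ≤ y) (w : A) : ‖e * w‖ ^ 2 ≤ κ⁻¹ * ‖star w * y * w‖ := by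
  have hconj : κ • (star (e * w) * (e * w)) ≤ star w * y * w := by
    simpa only [star_mul, he.star_eq, mul_assoc, mul_smul_comm, smul_mul_assoc] using
      star_left_conjugate_le_conjugate hey w
  have hnorm := CStarAlgebra.norm_le_norm_of_nonneg_of_le
    (smul_nonneg hκ.le (star_mul_self_nonneg _)) hconj
  rw [norm_smul, Real.norm_of_nonneg hκ.le, CStarRing.norm_star_mul_self, ← sq] at hnorm
  exact (le_inv_mul_iff₀ hκ).mpr hnorm

variable {A : Type*} [CStarAlgebra A]

theorem cfc_mem_closure_of_mem {B : Subalgebra ℂ A} {y : A} (hyB : y ∈ B) (hy : IsSelfAdjoint y)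
    (f : ℝ → ℝ) : cfc f y ∈ closure (B : Set A) := by
  have hadjoin : (StarAlgebra.adjoin ℝ {y}).toSubalgebra ≤ B.restrictScalars ℝ := by
    rw [StarAlgebra.adjoin_toSubalgebra, star_singleton, hy.star_eq, union_self]
    exact Algebra.adjoin_le (singleton_subset_iff.mpr hyB)
  exact closure_mono hadjoin (cfc_mem_elemental f y)

theorem cfc_mul_self_mul_cfc {y : A} (hy : IsSelfAdjoint y) {f : ℝ → ℝ}
    (hf : ContinuousOn f (spectrum ℝ y)) :
    cfc f y * y * cfc f y = cfc (fun t => f t * t * f t) y := by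
  rw [cfc_mul (fun t => f t * t) f y (hf.mul continuousOn_id) hf,
    cfc_mul f (fun t => t) y hf continuousOn_id, cfc_id' ℝ y]

/-- The regularised inverse square root `(y + η)^(-1/2)` of a positive element `y`, for `η > 0`. -/
noncomputable def invSqrtAdd (y : A) (η : ℝ) : A :=
  cfc (fun t : ℝ => (√(t + η))⁻¹) y

theorem isSelfAdjoint_invSqrtAdd (y : A) (η : ℝ) : IsSelfAdjoint (invSqrtAdd y η) :=
  cfc_predicate _ _

variable [PartialOrder A] [StarOrderedRing A] {e y : A} {κ η : ℝ}

theorem one_sub_invSqrtAdd_conj (hy : 0 ≤ y) (hη : 0 < η) :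
    1 - invSqrtAdd y η * y * invSqrtAdd y η = cfc (fun t : ℝ => η / (t + η)) y := by
  have hf : ContinuousOn (fun t : ℝ => (√(t + η))⁻¹) (spectrum ℝ y) := by
    refine ContinuousOn.inv₀ (by fun_prop) fun t ht => ?_
    have ht0 : 0 ≤ t := spectrum_nonneg_of_nonneg hy ht
    positivity
  have hf' : ContinuousOn (fun t : ℝ => (√(t + η))⁻¹ * t * (√(t + η))⁻¹) (spectrum ℝ y) :=
    (hf.mul continuousOn_id).mul hf
  rw [invSqrtAdd, cfc_mul_self_mul_cfc (.of_nonneg hy) hf, ← cfc_one ℝ y,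
    ← cfc_sub 1 _ y continuousOn_const hf']
  refine cfc_congr fun t ht => ?_
  have ht0 : 0 ≤ t := spectrum_nonneg_of_nonneg hy ht
  have hsqrt : √(t + η) ^ 2 = t + η := Real.sq_sqrt (by positivity)
  simp only [Pi.one_apply]
  field_simp
  rw [hsqrt]
  ring

theorem norm_mul_one_sub_invSqrtAdd_conj_sq_le (he : IsSelfAdjoint e) (hκ : 0 < κ)
    (hey : κ • (e * e) ≤ y) (hη : 0 < η) :
    ‖e * (1 - invSqrtAdd y η * y * invSqrtAdd y η)‖ ^ 2 ≤ κ⁻¹ * η := by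
  have hy : 0 ≤ y := (smul_nonneg hκ.le he.mul_self_nonneg).trans hey
  have hg : ContinuousOn (fun t : ℝ => η / (t + η)) (spectrum ℝ y) := by
    refine continuousOn_const.div (by fun_prop) fun t ht => ?_
    have ht0 : 0 ≤ t := spectrum_nonneg_of_nonneg hy ht
    positivity
  rw [one_sub_invSqrtAdd_conj hy hη]
  refine (norm_mul_sq_le_of_smul_mul_self_le he hκ hey _).trans ?_
  rw [(cfc_predicate (fun t : ℝ => η / (t + η)) y).star_eq,
    cfc_mul_self_mul_cfc (.of_nonneg hy) hg]
  gcongr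
  refine norm_cfc_le hη.le fun t ht => ?_
  have ht0 : 0 ≤ t := spectrum_nonneg_of_nonneg hy ht
  rw [Real.norm_of_nonneg (by positivity)]
  field_simp
  nlinarith [sq_nonneg η]

theorem tendsto_mul_invSqrtAdd_conj_mul (he : IsSelfAdjoint e) (hκ : 0 < κ)
    (hey : κ • (e * e) ≤ y) :
    Tendsto (fun η : ℝ => e * (invSqrtAdd y η * y * invSqrtAdd y η) * e) (𝓝[>] 0)
      (𝓝 (e * e)) := by
  have hsqrt : Tendsto (fun η : ℝ => √(κ⁻¹ * η)) (𝓝[>] 0) (𝓝 0) := by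
    have hcont : Continuous fun η : ℝ => √(κ⁻¹ * η) := by fun_prop
    simpa only [mul_zero, Real.sqrt_zero] using (hcont.tendsto 0).mono_left nhdsWithin_le_nhds
  have hone : Tendsto (fun η : ℝ => e * (1 - invSqrtAdd y η * y * invSqrtAdd y η))
      (𝓝[>] 0) (𝓝 0) := by
    refine squeeze_zero_norm' ?_ hsqrt
    filter_upwards [self_mem_nhdsWithin] with η hη
    exact Real.le_sqrt_of_sq_le (norm_mul_one_sub_invSqrtAdd_conj_sq_le he hκ hey hη)
  have hmul := (hone.mul_const e).const_sub (e * e)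
  rw [zero_mul, sub_zero] at hmul
  refine hmul.congr fun η => ?_
  noncomm_ring

theorem cuntzSubequiv_mul_self_of_smul_le {B : Subalgebra ℂ A} {a : A} (heB : e ∈ B)
    (haB : a ∈ B) (he : IsSelfAdjoint e) (hκ : 0 < κ) (hle : κ • (e * e) ≤ e * a * e) :
    CuntzSubequiv B (e * e) a := by
  have hy : IsSelfAdjoint (e * a * e) :=
    .of_nonneg ((smul_nonneg hκ.le he.mul_self_nonneg).trans hle)
  have hyB : e * a * e ∈ B := B.mul_mem (B.mul_mem heB haB) heB
  rw [cuntzSubequiv_iff_mem_closure]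
  refine isClosed_closure.mem_of_tendsto (tendsto_mul_invSqrtAdd_conj_mul he hκ hle)
    (.of_forall fun η => ?_)
  have hw := isSelfAdjoint_invSqrtAdd (e * a * e) η
  have hmem : e * invSqrtAdd (e * a * e) η * e * a * star (e * invSqrtAdd (e * a * e) η * e) ∈
      closure ((fun r => r * a * star r) '' (B : Set A)) := by
    refine map_mem_closure (f := fun x => e * x * e * a * star (e * x * e)) (by fun_prop)
      (cfc_mem_closure_of_mem hyB hy _) fun x hx => ?_
    exact ⟨e * x * e, B.mul_mem (B.mul_mem heB hx) heB, rfl⟩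
  rw [star_mul, star_mul, he.star_eq, hw.star_eq] at hmem
  simpa only [mul_assoc] using hmem

theorem smul_mul_self_le_conj_of_norm_sub_le {T φ : A} {μ : ℝ} (hT : IsSelfAdjoint T)
    (hφ : IsSelfAdjoint φ) (he : IsSelfAdjoint e) (hφe : φ * e = e)
    (h : ‖φ * T * φ - μ • (φ * φ)‖ ≤ μ - κ) : κ • (e * e) ≤ e * T * e := by
  have heφ : e * φ = e := by
    simpa only [star_mul, hφ.star_eq, he.star_eq] using congrArg star hφe
  have hD : IsSelfAdjoint (φ * T * φ - μ • (φ * φ)) :=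
    (hT.conjugate_self hφ).sub (.smul (.all μ) (.of_nonneg hφ.mul_self_nonneg))
  have hlow : algebraMap ℝ A (κ - μ) ≤ φ * T * φ - μ • (φ * φ) := by
    refine le_trans ?_ hD.neg_algebraMap_norm_le_self
    rw [← map_neg]
    exact algebraMap_mono A (by linarith)
  have hconj := he.conjugate_le_conjugate hlow
  have hleft : e * algebraMap ℝ A (κ - μ) * e = κ • (e * e) - μ • (e * e) := by
    rw [Algebra.algebraMap_eq_smul_one, mul_smul_comm, smul_mul_assoc, mul_one, sub_smul]
  have hright : e * (φ * T * φ - μ • (φ * φ)) * e = e * T * e - μ • (e * e) := by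
    have hT' : e * (φ * T * φ) * e = e * T * e := by
      calc e * (φ * T * φ) * e = (e * φ) * T * (φ * e) := by noncomm_ring
        _ = e * T * e := by rw [heφ, hφe]
    have hμ : e * (φ * φ) * e = e * e := by rw [← mul_assoc, heφ, mul_assoc, hφe]
    rw [mul_sub, sub_mul, hT', mul_smul_comm, smul_mul_assoc, hμ]
  rw [hleft, hright] at hconj
  exact sub_le_sub_iff_right _ |>.mp hconj

end CuntzComparison

theorem exists_isSelfAdjoint_mul_eq_right (𝕜 : Type*) [RCLike 𝕜] {X : Type*} [TopologicalSpace X]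
    [NormalSpace X] [T1Space X] {V : Set X} (hV : IsOpen V) {x : X} (hx : x ∈ V) :
    ∃ φ ψ : C(X, 𝕜), IsSelfAdjoint φ ∧ IsSelfAdjoint ψ ∧ φ * ψ = ψ ∧ ψ x = 1 ∧
      (∀ y, ‖φ y‖ ≤ 1) ∧ ∀ y, φ y ≠ 0 → y ∈ V := by
  obtain ⟨χ, hχV, hχx, hχ⟩ := exists_continuous_zero_one_of_isClosed hV.isClosed_compl
    (isClosed_singleton (x := x)) (disjoint_singleton_right.mpr (not_not.mpr hx))
  let φ : C(X, ℝ) := ⟨fun y => min (2 * χ y) 1, by fun_prop⟩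
  let ψ : C(X, ℝ) := ⟨fun y => max (2 * χ y - 1) 0, by fun_prop⟩
  have hφψ : φ * ψ = ψ := by
    ext y
    change min (2 * χ y) 1 * max (2 * χ y - 1) 0 = max (2 * χ y - 1) 0
    rcases le_total (2 * χ y) 1 with h | h
    · rw [max_eq_right (by linarith), mul_zero]
    · rw [min_eq_right h, one_mul]
  have hψx : ψ x = 1 := by
    norm_num [ψ, hχx rfl]
  have hφV : ∀ y, φ y ≠ 0 → y ∈ V := fun y hy => by
    by_contra hyV
    exact hy (by simp [φ, hχV hyV])
  have hφ1 : ∀ y, ‖φ y‖ ≤ 1 := fun y => by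
    have hφ0 : 0 ≤ φ y := le_min (mul_nonneg zero_le_two (hχ y).1) zero_le_one
    exact (Real.norm_of_nonneg hφ0).trans_le (min_le_right _ _)
  refine ⟨φ.realToRCLike 𝕜, ψ.realToRCLike 𝕜, ContinuousMap.isSelfAdjoint_realToRCLike 𝕜,
    ContinuousMap.isSelfAdjoint_realToRCLike 𝕜, ?_, ?_, fun y => ?_, fun y hy => hφV y ?_⟩
  · rw [← ContinuousMap.realToRCLike_mul, hφψ]
  · rw [ContinuousMap.realToRCLike_apply, hψx, RCLike.ofReal_one]
  · rw [ContinuousMap.realToRCLike_apply, RCLike.norm_ofReal]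
    exact hφ1 y
  · exact fun h => hy (by rw [ContinuousMap.realToRCLike_apply, h, RCLike.ofReal_zero])

theorem norm_finsum_le_of_subsingleton_support {ι E : Type*} [SeminormedAddCommGroup E]
    {f : ι → E} {C : ℝ} (hC : 0 ≤ C) (hf : (Function.support f).Subsingleton)
    (h : ∀ i, ‖f i‖ ≤ C) : ‖∑ᶠ i, f i‖ ≤ C := by
  obtain h0 | ⟨i, hi⟩ := hf.eq_empty_or_singleton
  · simpa [Function.support_eq_empty_iff.mp h0] using hC
  · rw [finsum_eq_single f i fun j hj => by_contra fun hfj => hj (hi.subset hfj)]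
    exact h i

theorem exists_pos_inner_apply_eq_of_apply_ne_zero {H : Type*} [NormedAddCommGroup H]
    [InnerProductSpace ℂ H] [CompleteSpace H] {T : H →L[ℂ] H} (hT : 0 ≤ T) {v : H}
    (hv : T v ≠ 0) : ∃ μ : ℝ, 0 < μ ∧ inner ℂ v (T v) = μ := by
  obtain ⟨c, rfl⟩ := CStarAlgebra.nonneg_iff_eq_star_mul_self.mp hT
  have hcv : c v ≠ 0 := fun h => hv (by rw [mul_apply_eq_comp, h, map_zero])
  refine ⟨‖c v‖ ^ 2, by positivity, ?_⟩
  rw [mul_apply_eq_comp, ContinuousLinearMap.star_eq_adjoint,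
    ContinuousLinearMap.adjoint_inner_right, inner_self_eq_norm_sq_to_K]
  norm_cast

namespace EtaleGroupoid

section Cancellation

variable {G G₀ : Type*} [TopologicalSpace G] [TopologicalSpace G₀] (𝒢 : EtaleGroupoid G G₀)

theorem inv_unit (u : G₀) : 𝒢.inv (𝒢.unit u) = 𝒢.unit u := by
  calc 𝒢.inv (𝒢.unit u) = 𝒢.mul (𝒢.inv (𝒢.unit u)) (𝒢.unit u) := by
        have h := 𝒢.mul_unit (𝒢.inv (𝒢.unit u))
        rwa [𝒢.s_inv, 𝒢.r_unit, eq_comm] at h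
    _ = 𝒢.unit u := by rw [𝒢.inv_mul, 𝒢.s_unit]

theorem mul_inv_mul_cancel {t g : G} (h : 𝒢.r t = 𝒢.r g) :
    𝒢.mul t (𝒢.mul (𝒢.inv t) g) = g := by
  rw [← 𝒢.mul_assoc _ _ _ (𝒢.r_inv t).symm ((𝒢.s_inv t).trans h), 𝒢.mul_inv, h, 𝒢.unit_mul]

theorem mul_mul_inv_cancel {t g : G} (h : 𝒢.s t = 𝒢.r g) :
    𝒢.mul (𝒢.mul t g) (𝒢.inv g) = t := by
  rw [𝒢.mul_assoc _ _ _ h (𝒢.r_inv g).symm, 𝒢.mul_inv, ← h, 𝒢.mul_unit]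

theorem r_inv_mul {t g : G} (h : 𝒢.r t = 𝒢.r g) : 𝒢.r (𝒢.mul (𝒢.inv t) g) = 𝒢.s t := by
  rw [𝒢.r_mul _ _ ((𝒢.s_inv t).trans h), 𝒢.r_inv]

theorem inv_mul_injective {t t' g : G} (ht : 𝒢.r t = 𝒢.r g) (ht' : 𝒢.r t' = 𝒢.r g)
    (h : 𝒢.mul (𝒢.inv t) g = 𝒢.mul (𝒢.inv t') g) : t = t' := by
  rw [← 𝒢.mul_mul_inv_cancel (𝒢.r_inv_mul ht).symm,
    ← 𝒢.mul_mul_inv_cancel (𝒢.r_inv_mul ht').symm, 𝒢.mul_inv_mul_cancel ht,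
    𝒢.mul_inv_mul_cancel ht', h]

end Cancellation

namespace Action

section Indices

variable {G G₀ X : Type*} [TopologicalSpace G] [TopologicalSpace G₀] [TopologicalSpace X]
  {𝒢 : EtaleGroupoid G G₀} {α : 𝒢.Action X}

theorem act_inv_act (α : 𝒢.Action X) {g : G} {x : X} (h : 𝒢.r g = α.rX x) :
    α.act g (α.act (𝒢.inv g) x) = x := by
  rw [α.act_act _ _ _ (𝒢.r_inv g).symm ((𝒢.s_inv g).trans h), 𝒢.mul_inv, h, α.unit_act]

theorem RegIndex.shift_injective (p : α.RegIndex) {t t' : G} (ht : 𝒢.r t = 𝒢.r p.g)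
    (ht' : 𝒢.r t' = 𝒢.r p.g) (h : p.shift t ht = p.shift t' ht') : t = t' :=
  𝒢.inv_mul_injective ht ht' (congrArg RegIndex.g h)

theorem apply_regIndex_congr (h : ∀ p : α.RegIndex, p.rep.H) (ρ : α.FibreRep) {g g' : G}
    (hgg' : g = g') (hg : 𝒢.s g = ρ.u) (hg' : 𝒢.s g' = ρ.u) :
    (show ρ.H from h ⟨ρ, g, hg⟩) = h ⟨ρ, g', hg'⟩ := by
  subst hgg'
  rfl

theorem apply_shift_unit (h : ∀ p : α.RegIndex, p.rep.H) (p : α.RegIndex) :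
    (show p.rep.H from h (p.shift (𝒢.unit (𝒢.r p.g)) (𝒢.r_unit _))) = h p :=
  apply_regIndex_congr h p.rep (by rw [𝒢.inv_unit, 𝒢.unit_mul]) _ _

/-- The action of `C(X)` on the summand of index `p = (u, π, g)` of the regular representation: the
function `a` acts by `π` of `x ↦ a (g x)`. -/
noncomputable def RegIndex.pullRep (p : α.RegIndex) : C(X, ℂ) →⋆ₐ[ℂ] (p.rep.H →L[ℂ] p.rep.H) :=
  p.rep.π.comp (ContinuousMap.compStarAlgHom' ℂ ℂ
    ((⟨Subtype.val, continuous_subtype_val⟩ : C(α.Fibre (𝒢.r p.g), X)).comp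
      (α.translate p.g p.hg rfl)))

theorem RegIndex.pullRep_congr (p : α.RegIndex) {a : C(X, ℂ)} {m : C(α.Fibre p.rep.u, ℂ)}
    (h : ∀ x, m x = a (α.act p.g x.1)) : p.rep.π m = p.pullRep a :=
  congrArg p.rep.π (ContinuousMap.ext h)

theorem eq_of_apply_apply_eq {S T : α.RegSpace →L[ℂ] α.RegSpace}
    (h : ∀ v p, S v p = T v p) : S = T :=
  ContinuousLinearMap.ext fun v => lp.ext (funext (h v))

end Indices

section Diagonal

variable {G G₀ X : Type*} [TopologicalSpace G] [TopologicalSpace G₀] [TopologicalSpace X]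
  {𝒢 : EtaleGroupoid G G₀} [T2Space G₀] [CompactSpace X] [T2Space X] {α : 𝒢.Action X}

theorem Bundle.continuous_eval :
    Continuous fun q : {q : α.Bundle × X // α.rX q.2 = q.1.base} => q.1.1.val ⟨q.1.2, q.2⟩ := by
  refine continuous_iff_continuousAt.mpr fun ⟨⟨b, x⟩, hx⟩ =>
    Metric.tendsto_nhds.mpr fun δ hδ => ?_
  obtain ⟨a, ha⟩ := ContinuousMap.exists_restrict_eq (α.isClosed_fibre b.base) b.val
  have restr_a : α.restr a b.base = b.val := ha
  let W : Set α.Bundle := {c | c.base ∈ univ ∧ ‖c.val - α.restr a c.base‖ < δ / 2}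
  have hW : IsOpen W := TopologicalSpace.isOpen_generateFrom_of_mem
    ⟨a, univ, δ / 2, isOpen_univ, half_pos hδ, rfl⟩
  have hbW : b ∈ W := ⟨mem_univ _, by simpa [restr_a] using hδ⟩
  have near_b : ∀ᶠ q : {q : α.Bundle × X // α.rX q.2 = q.1.base} in 𝓝 ⟨(b, x), hx⟩, q.1.1 ∈ W :=
    (hW.preimage (continuous_fst.comp continuous_subtype_val)).mem_nhds hbW
  have near_x : ∀ᶠ q : {q : α.Bundle × X // α.rX q.2 = q.1.base} in 𝓝 ⟨(b, x), hx⟩,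
      dist (a q.1.2) (a x) < δ / 2 :=
    Metric.tendsto_nhds.mp ((a.continuous.comp
      (continuous_snd.comp continuous_subtype_val)).tendsto _) _ (half_pos hδ)
  filter_upwards [near_b, near_x] with ⟨⟨c, y⟩, hy⟩ hc ha
  have hcy : dist (c.val ⟨y, hy⟩) (a y) < δ / 2 := by
    rw [dist_eq_norm]
    exact ((c.val - α.restr a c.base).norm_coe_le_norm ⟨y, hy⟩).trans_lt hc.2
  have hbx : b.val ⟨x, hx⟩ = a x := by rw [← restr_a]; rfl
  calc dist (c.val ⟨y, hy⟩) (b.val ⟨x, hx⟩) ≤ dist (c.val ⟨y, hy⟩) (a y) + dist (a y) (a x) :=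
        hbx ▸ dist_triangle _ _ _
    _ < δ := by linarith

/-- The restriction of a section to the unit space, as a function on `X`: its value at `y` is the
value at `y` of `f(r_X(y)) ∈ A(r_X(y))`. On sections this is the conditional expectation onto
`C(X)`. -/
noncomputable def Section.diagonal (f : α.Section) : C(X, ℂ) where
  toFun y := f.toFun (𝒢.unit (α.rX y)) ⟨y, (𝒢.r_unit _).symm⟩
  continuous_toFun := Bundle.continuous_eval.comp <| Continuous.subtype_mk
    ((f.continuous_toFun.comp (𝒢.continuous_unit.comp α.continuous_rX)).prodMk continuous_id)
    fun _ => (𝒢.r_unit _).symm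

theorem Section.toFun_unit_apply (f : α.Section) {u : G₀} {y : X} (hu : α.rX y = u) :
    f.toFun (𝒢.unit u) ⟨y, hu.trans (𝒢.r_unit u).symm⟩ = f.diagonal y := by
  subst hu
  rfl

theorem diagonal_ofFunction [T2Space G] (a : C(X, ℂ)) : (α.ofFunction a).diagonal = a := by
  ext y
  exact DFunLike.congr_fun (if_pos (mem_range_self (α.rX y)) :
    (α.ofFunction a).toFun (𝒢.unit (α.rX y)) = α.restr a _) _

theorem apply_regFun_eq_apply_diagonal {p : α.RegIndex} (S : p.rep.H →L[ℂ] p.rep.H)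
    (f : α.Section) (h : ∀ p : α.RegIndex, p.rep.H)
    (hS : ∀ t (ht : 𝒢.r t = 𝒢.r p.g), t ∉ range 𝒢.unit →
      S (p.rep.π (α.pull p.g p.hg ht.symm (f.toFun t)) (h (p.shift t ht))) = 0) :
    S (regFun f h p) = S (p.pullRep f.diagonal (h p)) := by
  have diagonal_term : p.rep.π (α.pull p.g p.hg (𝒢.r_unit _).symm
      (f.toFun (𝒢.unit (𝒢.r p.g)))) = p.pullRep f.diagonal :=
    p.pullRep_congr fun x => f.toFun_unit_apply (α.rX_act _ _ (p.hg.trans x.2.symm))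
  unfold regFun
  refine (S.toLinearMap.toAddMonoidHom.map_finsum (finite_support_regFun f h p)).trans ?_
  rw [finsum_eq_single _ (⟨𝒢.unit (𝒢.r p.g), 𝒢.r_unit _⟩ : {t : G // 𝒢.r t = 𝒢.r p.g})]
  · exact congrArg S ((congrArg _ (apply_shift_unit h p)).trans
      (DFunLike.congr_fun diagonal_term (h p)))
  · rintro ⟨t, ht⟩ hne
    refine hS t ht ?_
    rintro ⟨u, rfl⟩
    exact hne (Subtype.ext (congrArg 𝒢.unit ((𝒢.r_unit u).symm.trans ht)))

end Diagonal

section FunctionRep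

variable {G G₀ X : Type*} [TopologicalSpace G] [T2Space G] [TopologicalSpace G₀] [T2Space G₀]
  [TopologicalSpace X] [CompactSpace X] [T2Space X] {𝒢 : EtaleGroupoid G G₀} (α : 𝒢.Action X)

theorem regRep_ofFunction_apply (a : C(X, ℂ)) (v : α.RegSpace) (p : α.RegIndex) :
    regRep α (α.ofFunction a) v p = p.pullRep a (v p) := by
  have off_unit : ∀ t (ht : 𝒢.r t = 𝒢.r p.g), t ∉ range 𝒢.unit →
      p.rep.π (α.pull p.g p.hg ht.symm ((α.ofFunction a).toFun t)) (v (p.shift t ht)) = 0 := by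
    intro t ht hu
    have hz : α.pull p.g p.hg ht.symm ((α.ofFunction a).toFun t) = 0 :=
      congrArg (α.pull p.g p.hg ht.symm) (if_neg hu)
    rw [hz, map_zero]
    rfl
  have h1 := apply_regFun_eq_apply_diagonal (1 : p.rep.H →L[ℂ] p.rep.H) _ v off_unit
  rwa [diagonal_ofFunction] at h1

/-- The inclusion of `C(X)` into the reduced crossed product, as a representation on the space of
the regular representation. -/
noncomputable def functionRep : C(X, ℂ) →⋆ₐ[ℂ] (α.RegSpace →L[ℂ] α.RegSpace) where
  toFun a := regRep α (α.ofFunction a)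
  map_one' := eq_of_apply_apply_eq fun v p => by
    rw [regRep_ofFunction_apply, map_one]
    rfl
  map_mul' a b := eq_of_apply_apply_eq fun v p => by
    rw [mul_apply_eq_comp, regRep_ofFunction_apply, regRep_ofFunction_apply,
      regRep_ofFunction_apply, map_mul]
    rfl
  map_zero' := eq_of_apply_apply_eq fun v p => by
    rw [regRep_ofFunction_apply, map_zero]
    rfl
  map_add' a b := eq_of_apply_apply_eq fun v p => by
    change _ = regRep α _ v p + regRep α _ v p
    rw [regRep_ofFunction_apply, regRep_ofFunction_apply, regRep_ofFunction_apply, map_add]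
    rfl
  commutes' c := eq_of_apply_apply_eq fun v p => by
    rw [regRep_ofFunction_apply, AlgHomClass.commutes]
    rfl
  map_star' a := by
    rw [ContinuousLinearMap.star_eq_adjoint, ContinuousLinearMap.eq_adjoint_iff]
    intro v w
    simp only [lp.inner_eq_tsum, regRep_ofFunction_apply, map_star,
      ContinuousLinearMap.star_eq_adjoint, ContinuousLinearMap.adjoint_inner_left]

theorem functionRep_apply_apply (a : C(X, ℂ)) (v : α.RegSpace) (p : α.RegIndex) :
    α.functionRep a v p = p.pullRep a (v p) :=
  α.regRep_ofFunction_apply a v p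

variable {α}

/-- The off-diagonal terms `φ f(t) α_t(χ)` of the convolution `φ * f * χ` all vanish. -/
theorem functionRep_mul_regRep_mul_functionRep (f : α.Section) {φ χ : C(X, ℂ)}
    (hφχ : ∀ k z, 𝒢.s k = α.rX z → f.toFun k ≠ 0 → k ∉ range 𝒢.unit → φ (α.act k z) * χ z = 0) :
    α.functionRep φ * regRep α f * α.functionRep χ = α.functionRep (φ * f.diagonal * χ) := by
  refine eq_of_apply_apply_eq fun v p => ?_
  rw [mul_apply_eq_comp, mul_apply_eq_comp, functionRep_apply_apply, functionRep_apply_apply,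
    regRep_apply, map_mul, map_mul]
  refine (apply_regFun_eq_apply_diagonal (p.pullRep φ) f _ fun t ht hu => ?_).trans
    (congrArg (p.pullRep φ * p.pullRep f.diagonal) (α.functionRep_apply_apply χ v p))
  obtain ⟨m, w, hm, hw⟩ : ∃ (m : C(α.Fibre p.rep.u, ℂ)) (w : p.rep.H),
      (∀ x, m x = χ (α.act (𝒢.mul (𝒢.inv t) p.g) x.1)) ∧
        (show p.rep.H from α.functionRep χ v (p.shift t ht)) = p.rep.π m w :=
    ⟨_, v (p.shift t ht), fun _ => rfl, α.functionRep_apply_apply χ v (p.shift t ht)⟩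
  have product_eq_zero : α.pull p.g p.hg rfl (α.restr φ (𝒢.r p.g)) *
      α.pull p.g p.hg ht.symm (f.toFun t) * m = 0 := by
    ext x
    have hx : 𝒢.s p.g = α.rX x.1 := p.hg.trans x.2.symm
    have hy : 𝒢.r t = α.rX (α.act p.g x.1) := ht.trans (α.rX_act _ _ hx).symm
    change φ (α.act p.g x.1) * f.toFun t ⟨α.act p.g x.1, hy.symm⟩ * m x = 0
    by_cases hft : f.toFun t = 0
    · rw [hft, ContinuousMap.zero_apply, mul_zero, zero_mul]
    · have hz := hφχ t (α.act (𝒢.inv t) (α.act p.g x.1))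
        ((𝒢.r_inv t).symm.trans (α.rX_act _ _ ((𝒢.s_inv t).trans hy)).symm) hft hu
      rw [α.act_inv_act hy] at hz
      rw [hm, ← α.act_act _ _ _ ((𝒢.s_inv t).trans ht) hx, mul_right_comm, hz, zero_mul]
  have operator_eq_zero := congrArg p.rep.π product_eq_zero
  rw [map_mul, map_mul, map_zero] at operator_eq_zero
  exact (congrArg (fun w => p.pullRep φ (p.rep.π (α.pull p.g p.hg ht.symm (f.toFun t)) w)) hw).trans
    (DFunLike.congr_fun operator_eq_zero w)

end FunctionRep

section PointEvaluations

variable {G G₀ X : Type*} [TopologicalSpace G] [TopologicalSpace G₀] [TopologicalSpace X]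
  {𝒢 : EtaleGroupoid G G₀} (α : 𝒢.Action X)

/-- Evaluation at the point `x`, as a one-dimensional representation of the fibre algebra
`A(r_X(x))`. -/
noncomputable def pointRep (x : X) : α.FibreRep where
  u := α.rX x
  H := ℂ
  π := (StarAlgHom.ofId ℂ (ℂ →L[ℂ] ℂ)).comp
    (ContinuousMap.evalStarAlgHom ℂ ℂ (⟨x, rfl⟩ : α.Fibre (α.rX x)))

theorem pointRep_π_apply (x : X) (f : C(α.Fibre (α.rX x), ℂ)) (z : ℂ) :
    (α.pointRep x).π f z = f ⟨x, rfl⟩ * z := rfl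

/-- The index of the unit `r_X(x)` in the summand of the regular representation given by the
evaluation at `x`. -/
noncomputable def pointIndex (x : X) : α.RegIndex :=
  ⟨α.pointRep x, 𝒢.unit (α.rX x), 𝒢.s_unit _⟩

open Classical in
/-- The basis vector of the regular representation of index `α.pointIndex x`. It carries the state
"evaluation at `x`" of `C(X)`. -/
noncomputable def pointVector (x : X) : α.RegSpace :=
  lp.single 2 (α.pointIndex x) (1 : ℂ)

/-- The value at `x` of the conditional expectation of the operator `T` onto `C(X)`, that is, its
diagonal matrix coefficient at `α.pointVector x`. -/
noncomputable def expectation (T : α.RegSpace →L[ℂ] α.RegSpace) (x : X) : ℂ :=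
  inner ℂ (α.pointVector x) (T (α.pointVector x))

theorem norm_single [DecidableEq α.RegIndex] (p : α.RegIndex) (ξ : p.rep.H) :
    ‖(lp.single 2 p ξ : α.RegSpace)‖ = ‖ξ‖ :=
  lp.norm_single (E := fun p : α.RegIndex => p.rep.H) two_pos p ξ

theorem norm_pointVector (x : X) : ‖α.pointVector x‖ = 1 := by
  classical
  exact (α.norm_single (α.pointIndex x) (1 : ℂ)).trans (norm_one (α := ℂ))

theorem pointVector_apply_self (x : X) : α.pointVector x (α.pointIndex x) = (1 : ℂ) := by
  classical
  exact lp.single_apply_self (E := fun p : α.RegIndex => p.rep.H) 2 (α.pointIndex x) (1 : ℂ)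

theorem pointVector_apply_of_ne (x : X) {p : α.RegIndex} (hp : p ≠ α.pointIndex x) :
    α.pointVector x p = 0 := by
  classical
  exact lp.single_apply_ne (E := fun p : α.RegIndex => p.rep.H) 2 (α.pointIndex x) (1 : ℂ) hp

theorem inner_pointVector_left (x : X) (v : α.RegSpace) :
    inner ℂ (α.pointVector x) v = (show ℂ from v (α.pointIndex x)) := by
  classical
  refine (lp.inner_single_left (G := fun p : α.RegIndex => p.rep.H) (𝕜 := ℂ)
    (α.pointIndex x) (1 : ℂ) v).trans ((RCLike.inner_apply (𝕜 := ℂ) _ _).trans ?_)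
  rw [map_one]
  exact mul_one (M := ℂ) _

theorem norm_expectation_sub_le (S T : α.RegSpace →L[ℂ] α.RegSpace) (x : X) :
    ‖α.expectation S x - α.expectation T x‖ ≤ ‖S - T‖ := by
  rw [expectation, expectation, ← inner_sub_right, ← sub_apply]
  calc ‖inner ℂ (α.pointVector x) ((S - T) (α.pointVector x))‖
      ≤ ‖α.pointVector x‖ * ‖(S - T) (α.pointVector x)‖ := norm_inner_le_norm _ _
    _ ≤ ‖S - T‖ := by
      rw [norm_pointVector, one_mul]
      simpa only [norm_pointVector, mul_one] using (S - T).le_opNorm (α.pointVector x)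

variable {α} [T2Space G₀] [CompactSpace X]

theorem regFun_pointVector (f : α.Section) {x : X} {k : G} (hk : 𝒢.s k = α.rX x) :
    regFun f (α.pointVector x) ⟨α.pointRep x, k, hk⟩ = f.toFun k ⟨α.act k x, α.rX_act k x hk⟩ := by
  unfold regFun
  rw [finsum_eq_single _ (⟨k, rfl⟩ : {t : G // 𝒢.r t = 𝒢.r k})]
  · have h1 : α.pointVector x (RegIndex.shift ⟨α.pointRep x, k, hk⟩ k rfl) = (1 : ℂ) :=
      (apply_regIndex_congr (α.pointVector x) (α.pointRep x)
        ((𝒢.inv_mul k).trans (congrArg 𝒢.unit hk)) _ (𝒢.s_unit _)).trans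
          (α.pointVector_apply_self x)
    rw [h1]
    exact (α.pointRep_π_apply x _ _).trans (mul_one (M := ℂ) _)
  · intro t ht
    have h0 : α.pointVector x (RegIndex.shift ⟨α.pointRep x, k, hk⟩ t.1 t.2) = (0 : ℂ) := by
      refine α.pointVector_apply_of_ne x fun h => ht (Subtype.ext (𝒢.inv_mul_injective t.2 rfl ?_))
      rw [𝒢.inv_mul, hk]
      exact congrArg RegIndex.g h
    rw [h0]
    exact map_zero _

theorem expectation_regRep [T2Space X] (f : α.Section) (x : X) :
    α.expectation (regRep α f) x = f.diagonal x := by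
  have h := regFun_pointVector f (𝒢.s_unit (α.rX x))
  simp only [α.unit_act] at h
  exact (α.inner_pointVector_left x _).trans h

theorem norm_toFun_apply_le_of_norm_regRep_pointVector_le [T2Space X] {f : α.Section} {C : ℝ}
    (hC : ∀ x, ‖regRep α f (α.pointVector x)‖ ≤ C) (k : G) (y : α.Fibre (𝒢.r k)) :
    ‖f.toFun k y‖ ≤ C := by
  obtain ⟨y, hy⟩ := y
  have hs : 𝒢.s k = α.rX (α.act (𝒢.inv k) y) := by
    rw [α.rX_act _ _ ((𝒢.s_inv k).trans hy.symm), 𝒢.r_inv]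
  have h := regFun_pointVector f hs
  simp only [α.act_inv_act hy.symm] at h
  rw [← h]
  exact (lp.norm_apply_le_norm two_ne_zero (regRep α f (α.pointVector _)) _).trans (hC _)

theorem FibreRep.norm_π_apply_le (ρ : α.FibreRep) {f : C(α.Fibre ρ.u, ℂ)} {C : ℝ} (hC : 0 ≤ C)
    (hf : ∀ x, ‖f x‖ ≤ C) (ξ : ρ.H) : ‖ρ.π f ξ‖ ≤ C * ‖ξ‖ := by
  refine (ρ.π f).le_of_opNorm_le ?_ ξ
  exact (NonUnitalStarAlgHom.norm_apply_le ρ.π f).trans ((ContinuousMap.norm_le _ hC).mpr hf)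

/-- Only the arrow `t` with `t⁻¹ q = p` contributes to the matrix coefficient at `(q, p)`. -/
theorem norm_regFun_single_apply_le [DecidableEq α.RegIndex] {f : α.Section} {C : ℝ} (hC : 0 ≤ C)
    (hf : ∀ k y, ‖f.toFun k y‖ ≤ C) (p q : α.RegIndex) (ξ : p.rep.H) :
    ‖regFun f (lp.single 2 p ξ : α.RegSpace) q‖ ≤ C * ‖ξ‖ := by
  have eq_of_term_ne_zero : ∀ t : {t : G // 𝒢.r t = 𝒢.r q.g},
      q.rep.π (α.pull q.g q.hg t.2.symm (f.toFun t.1))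
        ((lp.single 2 p ξ : α.RegSpace) (q.shift t.1 t.2)) ≠ 0 → q.shift t.1 t.2 = p := by
    intro t ht
    by_contra hne
    refine ht ?_
    rw [lp.single_apply_ne _ _ _ hne]
    exact map_zero _
  refine norm_finsum_le_of_subsingleton_support (by positivity) (fun t ht t' ht' => Subtype.ext
    (q.shift_injective t.2 t'.2 ((eq_of_term_ne_zero t ht).trans
      (eq_of_term_ne_zero t' ht').symm))) fun t => ?_
  refine (q.rep.norm_π_apply_le hC (fun x => hf _ _) _).trans ?_
  gcongr
  exact (lp.norm_apply_le_norm two_ne_zero (lp.single 2 p ξ : α.RegSpace) _).trans_eq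
    (α.norm_single p ξ)

/-- As `E(T⋆T)(x) = ‖T ξ_x‖²` for the conditional expectation `E` and the basis vector `ξ_x` at `x`,
this is the faithfulness of `E`. -/
theorem eq_zero_of_apply_pointVector_eq_zero [T2Space X] {T : α.RegSpace →L[ℂ] α.RegSpace}
    (hT : T ∈ closure (range (regRep α))) (h0 : ∀ x, T (α.pointVector x) = 0) : T = 0 := by
  classical
  obtain ⟨L, hL, hLT⟩ := mem_closure_iff_seq_limit.mp hT
  choose f hf using hL
  obtain rfl : (fun n => regRep α (f n)) = L := funext hf
  have norm_le : ∀ n (p q : α.RegIndex) (ξ : p.rep.H),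
      ‖(regRep α (f n) (lp.single 2 p ξ) : α.RegSpace) q‖ ≤ ‖regRep α (f n) - T‖ * ‖ξ‖ := by
    intro n p q ξ
    refine norm_regFun_single_apply_le (norm_nonneg _)
      (norm_toFun_apply_le_of_norm_regRep_pointVector_le fun x => ?_) p q ξ
    simpa only [sub_apply, h0, sub_zero, norm_pointVector, mul_one] using
      (regRep α (f n) - T).le_opNorm (α.pointVector x)
  refine lp.ext_continuousLinearMap (by norm_num) fun p => ContinuousLinearMap.ext fun ξ =>
    lp.ext (funext fun q => ?_)
  have tendsto_apply : Tendsto (fun n => (regRep α (f n) (lp.single 2 p ξ) : α.RegSpace) q) atTop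
      (𝓝 ((T (lp.single 2 p ξ) : α.RegSpace) q)) :=
    ((lp.evalCLM ℂ (fun p : α.RegIndex => p.rep.H) 2 q).continuous.comp
      (continuous_eval_const (lp.single 2 p ξ : α.RegSpace))).tendsto T |>.comp hLT
  refine tendsto_nhds_unique tendsto_apply (squeeze_zero_norm (norm_le · p q ξ) ?_)
  simpa only [zero_mul] using (tendsto_iff_norm_sub_tendsto_zero.mp hLT).mul_const ‖ξ‖

theorem exists_expectation_eq_pos [T2Space X] {T : α.RegSpace →L[ℂ] α.RegSpace}
    (hT : T ∈ closure (range (regRep α))) (hT0 : 0 ≤ T) (hT1 : T ≠ 0) :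
    ∃ (x : X) (μ : ℝ), 0 < μ ∧ α.expectation T x = μ := by
  obtain ⟨x, hx⟩ : ∃ x, T (α.pointVector x) ≠ 0 := by
    by_contra! h
    exact hT1 (eq_zero_of_apply_pointVector_eq_zero hT h)
  exact ⟨x, exists_pos_inner_apply_eq_of_apply_ne_zero hT0 hx⟩

end PointEvaluations

section TopologicalFreeness

variable {G G₀ X : Type*} [TopologicalSpace G] [TopologicalSpace G₀] [TopologicalSpace X]
  {𝒢 : EtaleGroupoid G G₀}

/-- The isotropy of the action at the point `x` is trivial: only the unit at `r_X(x)` fixes `x`. -/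
def HasTrivialIsotropyAt (α : 𝒢.Action X) (x : X) : Prop :=
  ∀ g : G, 𝒢.s g = α.rX x → α.act g x = x → g = 𝒢.unit (α.rX x)

/-- The action is topologically free: the points with trivial isotropy are dense. -/
def IsTopologicallyFree (α : 𝒢.Action X) : Prop :=
  Dense {x | α.HasTrivialIsotropyAt x}

theorem IsFree.isTopologicallyFree {α : 𝒢.Action X} (hα : α.IsFree) : α.IsTopologicallyFree :=
  fun x => subset_closure fun g => hα g x

/-- The pairs `(z, k z)` with `k ∈ K` not a unit form a compact set that misses `(x, x)`. -/
theorem HasTrivialIsotropyAt.exists_mem_nhds [T2Space G₀] [CompactSpace X] [T2Space X]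
    {α : 𝒢.Action X} {x : X} (hx : α.HasTrivialIsotropyAt x) {K : Set G} (hK : IsCompact K) :
    ∃ U ∈ 𝓝 x, ∀ k ∈ K, k ∉ range 𝒢.unit → ∀ z ∈ U, 𝒢.s k = α.rX z → α.act k z ∉ U := by
  set S : Set (G × X) := ((K \ range 𝒢.unit) ×ˢ univ) ∩ {p | 𝒢.s p.1 = α.rX p.2}
  have hS : IsCompact S :=
    ((hK.diff 𝒢.isOpen_range_unit).prod isCompact_univ).inter_right
      (isClosed_eq (𝒢.isLocalHomeomorph_s.continuous.comp continuous_fst)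
        (α.continuous_rX.comp continuous_snd))
  have hcont : ContinuousOn (fun p : G × X => (p.2, α.act p.1 p.2)) S :=
    continuous_snd.continuousOn.prodMk (α.continuousOn_act.mono inter_subset_right)
  have hxS : (x, x) ∉ (fun p : G × X => (p.2, α.act p.1 p.2)) '' S := by
    rintro ⟨⟨k, z⟩, ⟨⟨⟨-, hk⟩, -⟩, hs⟩, hkz⟩
    obtain ⟨rfl, hfix⟩ := Prod.mk.inj hkz
    exact hk ⟨_, (hx k hs hfix).symm⟩
  have hnhds := (hS.image_of_continuousOn hcont).isClosed.isOpen_compl.mem_nhds hxS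
  rw [nhds_prod_eq, mem_prod_same_iff] at hnhds
  obtain ⟨U, hU, hUS⟩ := hnhds
  refine ⟨U, hU, fun k hk hku z hz hs hkz => ?_⟩
  exact hUS (show (z, α.act k z) ∈ U ×ˢ U from ⟨hz, hkz⟩)
    ⟨(k, z), ⟨⟨⟨hk, hku⟩, mem_univ _⟩, hs⟩, rfl⟩

end TopologicalFreeness

section Compression

variable {G G₀ X : Type*} [TopologicalSpace G] [T2Space G] [TopologicalSpace G₀] [T2Space G₀]
  [TopologicalSpace X] [CompactSpace X] [T2Space X] {𝒢 : EtaleGroupoid G G₀} {α : 𝒢.Action X}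

theorem IsTopologicallyFree.exists_functionRep_mul_regRep_mul_eq (hα : α.IsTopologicallyFree)
    (f : α.Section) {V : Set X} (hV : IsOpen V) (hVne : V.Nonempty) :
    ∃ φ ψ : C(X, ℂ), IsSelfAdjoint φ ∧ IsSelfAdjoint ψ ∧ φ * ψ = ψ ∧ ψ ≠ 0 ∧ (∀ y, ‖φ y‖ ≤ 1) ∧
      (∀ y, φ y ≠ 0 → y ∈ V) ∧
      α.functionRep φ * regRep α f * α.functionRep φ = α.functionRep (φ * f.diagonal * φ) := by
  obtain ⟨x, hxV, hx⟩ := hα.inter_open_nonempty V hV hVne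
  obtain ⟨U, hU, hUf⟩ := hx.exists_mem_nhds f.isCompact_support
  obtain ⟨W, hWsub, hW, hxW⟩ := mem_nhds_iff.mp (inter_mem hU (hV.mem_nhds hxV))
  obtain ⟨φ, ψ, hφ, hψ, hφψ, hψx, hφ1, hφW⟩ := exists_isSelfAdjoint_mul_eq_right ℂ hW hxW
  have hψ0 : ψ ≠ 0 := fun h => zero_ne_one (by rwa [h] at hψx)
  refine ⟨φ, ψ, hφ, hψ, hφψ, hψ0, hφ1, fun y hy => (hWsub (hφW y hy)).2,
    functionRep_mul_regRep_mul_functionRep f fun k z hs hk hu => ?_⟩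
  by_contra h
  exact hUf k (subset_closure hk) hu z (hWsub (hφW _ (right_ne_zero_of_mul h))).1 hs
    (hWsub (hφW _ (left_ne_zero_of_mul h))).1

theorem norm_functionRep_le (a : C(X, ℂ)) : ‖α.functionRep a‖ ≤ ‖a‖ :=
  NonUnitalStarAlgHom.norm_apply_le α.functionRep a

theorem norm_conj_sub_smul_mul_self_le {f : α.Section} {T : α.RegSpace →L[ℂ] α.RegSpace}
    {φ : C(X, ℂ)} {μ : ℂ} {δ ε : ℝ} (hδ : 0 ≤ δ) (hTf : ‖T - regRep α f‖ ≤ ε)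
    (hφ1 : ∀ y, ‖φ y‖ ≤ 1) (hμ : ∀ y, φ y ≠ 0 → ‖f.diagonal y - μ‖ ≤ δ)
    (hconj : α.functionRep φ * regRep α f * α.functionRep φ =
      α.functionRep (φ * f.diagonal * φ)) :
    ‖α.functionRep φ * T * α.functionRep φ - μ • (α.functionRep φ * α.functionRep φ)‖
      ≤ ε + δ := by
  have hφ : ‖α.functionRep φ‖ ≤ 1 :=
    (norm_functionRep_le φ).trans ((ContinuousMap.norm_le _ zero_le_one).mpr hφ1)
  have hdiag : ‖φ * (f.diagonal - μ • 1) * φ‖ ≤ δ := by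
    refine (ContinuousMap.norm_le _ hδ).mpr fun y => ?_
    by_cases hy : φ y = 0
    · simpa [hy] using hδ
    · calc ‖φ y * (f.diagonal y - μ • 1) * φ y‖ = ‖φ y‖ * ‖f.diagonal y - μ‖ * ‖φ y‖ := by
            rw [norm_mul, norm_mul, smul_eq_mul, mul_one]
        _ ≤ 1 * δ * 1 := by gcongr <;> first | exact hφ1 y | exact hμ y hy
        _ = δ := by ring
  have split : α.functionRep φ * T * α.functionRep φ -
      μ • (α.functionRep φ * α.functionRep φ) =
      α.functionRep φ * (T - regRep α f) * α.functionRep φ +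
        α.functionRep (φ * (f.diagonal - μ • 1) * φ) := by
    simp only [mul_sub, sub_mul, map_sub, hconj, mul_smul_comm, smul_mul_assoc, map_smul, mul_one,
      map_mul]
    abel
  have hε : 0 ≤ ε := (norm_nonneg _).trans hTf
  rw [split]
  refine norm_add_le_of_le ?_ ((norm_functionRep_le _).trans hdiag)
  calc ‖α.functionRep φ * (T - regRep α f) * α.functionRep φ‖
      ≤ ‖α.functionRep φ‖ * ‖T - regRep α f‖ * ‖α.functionRep φ‖ := norm_mul₃_le
    _ ≤ 1 * ε * 1 := by gcongr
    _ = ε := by ring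

theorem IsTopologicallyFree.exists_smul_mul_self_le_conj (hα : α.IsTopologicallyFree)
    {T : α.RegSpace →L[ℂ] α.RegSpace} (hT : T ∈ closure (range (regRep α))) (hT0 : 0 ≤ T)
    (hT1 : T ≠ 0) :
    ∃ (ψ : C(X, ℂ)) (κ : ℝ), IsSelfAdjoint ψ ∧ ψ ≠ 0 ∧ 0 < κ ∧
      κ • (α.functionRep ψ * α.functionRep ψ) ≤ α.functionRep ψ * T * α.functionRep ψ := by
  obtain ⟨x, μ, hμ, hx⟩ := exists_expectation_eq_pos hT hT0 hT1
  obtain ⟨_, ⟨f, rfl⟩, hf⟩ := Metric.mem_closure_iff.mp hT (μ / 4) (by positivity)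
  rw [dist_eq_norm] at hf
  have hfx : ‖f.diagonal x - μ‖ < μ / 2 := by
    rw [← expectation_regRep, ← hx, norm_sub_rev]
    exact (α.norm_expectation_sub_le _ _ x).trans_lt (hf.trans (by linarith))
  obtain ⟨φ, ψ, hφ, hψ, hφψ, hψ0, hφ1, hφV, hconj⟩ :=
    hα.exists_functionRep_mul_regRep_mul_eq f
      (V := {y | ‖f.diagonal y - μ‖ < μ / 2}) (isOpen_lt (by fun_prop) continuous_const) ⟨x, hfx⟩
  refine ⟨ψ, μ / 4, hψ, hψ0, by positivity, smul_mul_self_le_conj_of_norm_sub_le (μ := μ)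
    hT0.isSelfAdjoint (hφ.map α.functionRep) (hψ.map α.functionRep)
    (by rw [← map_mul, hφψ]) ?_⟩
  have h := norm_conj_sub_smul_mul_self_le (by positivity) hf.le hφ1
    (fun y hy => (hφV y hy).le) hconj
  rw [Complex.coe_smul] at h
  linarith

end Compression

end Action

end EtaleGroupoid

theorem mainTheorem8_general {G G₀ X : Type*} [TopologicalSpace G] [T2Space G]
    [TopologicalSpace G₀] [T2Space G₀] [TopologicalSpace X] [CompactSpace X] [T2Space X]
    (𝒢 : EtaleGroupoid G G₀) (α : 𝒢.Action X) (hfree : α.IsTopologicallyFree)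
    (B : Subalgebra ℂ α.crossedProduct) (hCX : ∀ f : C(X, ℂ), α.incl f ∈ B)
    (a : α.crossedProduct) (ha_closure : a ∈ closure (range α.ofSection)) (haB : a ∈ B)
    (ha : IsPositiveElem a) (ha0 : a ≠ 0) :
    ∃ b : C(X, ℂ), IsPositiveElem b ∧ b ≠ 0 ∧ CuntzSubequiv B (α.incl b) a := by
  have hT : (a : α.RegSpace →L[ℂ] α.RegSpace) ∈ closure (range (EtaleGroupoid.Action.regRep α)) :=
    map_mem_closure continuous_subtype_val ha_closure (by rintro _ ⟨f, rfl⟩; exact ⟨f, rfl⟩)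
  have hT0 : (0 : α.RegSpace →L[ℂ] α.RegSpace) ≤ a := by
    obtain ⟨c, rfl⟩ := ha
    exact star_mul_self_nonneg (c : α.RegSpace →L[ℂ] α.RegSpace)
  obtain ⟨ψ, κ, hψ, hψ0, hκ, hle⟩ :=
    hfree.exists_smul_mul_self_le_conj hT hT0 (by simpa using ha0)
  refine ⟨star ψ * ψ, ⟨ψ, rfl⟩, (CStarRing.star_mul_self_ne_zero_iff ψ).mpr hψ0, ?_⟩
  refine CuntzSubequiv.of_map α.crossedProduct.subtype .subtypeVal ?_
  change CuntzSubequiv _ (α.functionRep (star ψ * ψ)) (a : α.RegSpace →L[ℂ] α.RegSpace)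
  rw [hψ.star_eq, map_mul]
  exact cuntzSubequiv_mul_self_of_smul_le (mem_image_of_mem _ (hCX ψ)) (mem_image_of_mem _ haB)
    (hψ.map α.functionRep) hκ hle

theorem mainTheorem8 {G G₀ X : Type*}
    [TopologicalSpace G] [T2Space G] [LocallyCompactSpace G]
    [TopologicalSpace G₀] [T2Space G₀]
    [TopologicalSpace X] [CompactSpace X] [T2Space X]
    (𝒢 : EtaleGroupoid G G₀) (α : 𝒢.Action X) (hfree : α.IsFree)
    (B : Subalgebra ℂ α.crossedProduct)
    (hCX : ∀ f : C(X, ℂ), α.incl f ∈ B)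
    (hdense : ∀ b ∈ B, b ∈ closure ((B : Set α.crossedProduct) ∩ Set.range α.ofSection))
    (a : α.crossedProduct) (haB : a ∈ B) (ha : IsPositiveElem a) (ha0 : a ≠ 0) :
    ∃ b : C(X, ℂ), IsPositiveElem b ∧ b ≠ 0 ∧ CuntzSubequiv B (α.incl b) a :=
  mainTheorem8_general 𝒢 α hfree.isTopologicallyFree B hCX a
    (closure_mono inter_subset_right (hdense a haB)) haB ha ha0
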